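/- **Theorem.** Let $\mathcal X,\mathcal Y$ be finite sets and let $W(y|x)$, $x\in\mathcal X$, $y\in\mathcal Y$, be a stochastic matrix, regarded as a discrete memoryless channel $\mathcal W$: $W^n(y^n|x^n)=\prod_{t=1}^n W(y_t|x_t)$, and $W^n(D|x^n)=\sum_{y^n\in D}W^n(y^n|x^n)$ for $D\subseteq\mathcal Y^n$. Let $\phi:\mathcal X\to[0,\infty)$ be a cost function with $\phi(x_0)=0$ for some $x_0\in\mathcal X$, and let $A\ge 0$. An $(M,n,\lambda_1,\lambda_2)$ *deterministic identification (DI) code* under the input constraint $A$ consists of codewords $u_1,\dots,u_M\in\mathcal X^n$ with $\frac1n\sum_{t=1}^n\phi(u_{i}(t))\le A$ for all $i$, and of sets $D_1,\dots,D_M\subseteq\mathcal Y^n$ (not necessarily disjoint), such that $W^n(D_i^c|u_i)\le\lambda_1$ for all $i$ and $W^n(D_j|u_i)\le\lambda_2$ for all $i\ne j$. A rate $R>0$ is *achievable* if for all $\lambda_1,\lambda_2>0$ there is, for every sufficiently large $n$, a $(\lceil 2^{nR}\rceil,n,\lambda_1,\lambda_2)$ DI code; it is *achievable in the double-exponential scale*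 if the same holds with $\lceil 2^{2^{nR}}\rceil$ messages. Let $\mathbb C_{DI}(\mathcal W)$ and $\underline{\mathbb C}_{DI}(\mathcal W)$ be the suprema in $[0,\infty]$ of the rates $R>0$ achievable in the first and in the second sense, respectively (with $\sup\emptyset=0$). Call two letters $x,x'\in\mathcal X$ equivalent if $W(y|x)=W(y|x')$ for all $y\in\mathcal Y$. From each equivalence class choose (arbitrarily, if there are several) a letter of lowest cost $\phi$ in the class, and let $\mathcal X_r\subseteq\mathcal X$ be the set of the chosen letters. Then, for every such choice, $$\mathbb C_{DI}(\mathcal W)=\max\{H(X) : X\sim p_X,\ p_X \text{ a probability mass function on } \mathcal X_r,\ \mathbb E[\phi(X)]\le A\},$$ where $H(X)=-\sum_{x}p_X(x)\log_2p_X(x)$ and the maximum is attained. Moreover, $\underline{\mathbb C}_{DI}(\mathcal W)=0$. -/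

import Mathlib

open Filter
open scoped ENNReal

/-- A discrete memoryless channel with finite output alphabet `Y`: a stochastic matrix
`W x y = W(y | x)`. -/
structure DMC (X Y : Type*) [Fintype Y] where
  W : X → Y → ℝ
  nonneg : ∀ x y, 0 ≤ W x y
  sum_eq_one : ∀ x, ∑ y, W x y = 1

namespace DMC

/-- The `n`-letter law `W^n(y^n | x^n) = ∏ t, W(y_t | x_t)`. -/
def seqProb {X Y : Type*} [Fintype Y] (C : DMC X Y) {n : ℕ}
    (x : Fin n → X) (y : Fin n → Y) : ℝ :=
  ∏ t, C.W (x t) (y t)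

open Classical in
/-- `W^n(D | x^n)` for a set `D` of output sequences. -/
noncomputable def prob {X Y : Type*} [Fintype Y] (C : DMC X Y) {n : ℕ}
    (D : Set (Fin n → Y)) (x : Fin n → X) : ℝ :=
  ∑ y : Fin n → Y with y ∈ D, C.seqProb x y

end DMC

/-- The cost `φ^n(x^n) = (1/n) ∑ t, φ(x_t)` of an input sequence. -/
noncomputable def seqCost {X : Type*} (φ : X → ℝ) {n : ℕ} (x : Fin n → X) : ℝ :=
  (1 / (n : ℝ)) * ∑ t, φ (x t)

/-- An `(M, n, l₁, l₂)` deterministic identification code for `C` under the input constraint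
`φ^n(u_i) ≤ A`: codewords `u_i` and (possibly overlapping) decoding regions `D_i`, with
missed-identification errors at most `l₁` and false-identification errors at most `l₂`. -/
structure DICode {X Y : Type*} [Fintype Y] (C : DMC X Y) (φ : X → ℝ) (A : ℝ)
    (M n : ℕ) (l₁ l₂ : ℝ) where
  u : Fin M → (Fin n → X)
  D : Fin M → Set (Fin n → Y)
  cost_le : ∀ i, seqCost φ (u i) ≤ A
  missed_le : ∀ i, C.prob (D i)ᶜ (u i) ≤ l₁
  false_le : ∀ i j, i ≠ j → C.prob (D j) (u i) ≤ l₂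

namespace DMC

/-- For all error levels `l₁, l₂ > 0` and all sufficiently large `n`, there is a deterministic
identification code with `size n` messages, block length `n` and errors at most `l₁`, `l₂`. -/
def AchievableSize {X Y : Type*} [Fintype Y] (C : DMC X Y) (φ : X → ℝ) (A : ℝ)
    (size : ℕ → ℕ) : Prop :=
  ∀ l₁ l₂ : ℝ, 0 < l₁ → 0 < l₂ → ∀ᶠ n : ℕ in atTop,
    Nonempty (DICode C φ A (size n) n l₁ l₂)

/-- The rate `R` is achievable with `2^(nR)` messages (rounded up to an integer). -/
def AchievableRate {X Y : Type*} [Fintype Y] (C : DMC X Y) (φ : X → ℝ) (A R : ℝ) : Prop :=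
  C.AchievableSize φ A fun n => ⌈(2 : ℝ) ^ ((n : ℝ) * R)⌉₊

/-- The rate `R` is achievable in the double-exponential scale, with `2^(2^(nR))` messages
(rounded up to an integer). -/
def AchievableRateDoubleExp {X Y : Type*} [Fintype Y] (C : DMC X Y) (φ : X → ℝ)
    (A R : ℝ) : Prop :=
  C.AchievableSize φ A fun n => ⌈(2 : ℝ) ^ ((2 : ℝ) ^ ((n : ℝ) * R))⌉₊

/-- The operational deterministic identification capacity: the supremum in `[0, ∞]` of the
achievable rates `R > 0` (so `0` if there are none, `∞` if they are unbounded). -/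
noncomputable def diCapacity {X Y : Type*} [Fintype Y] (C : DMC X Y) (φ : X → ℝ)
    (A : ℝ) : ℝ≥0∞ :=
  sSup (ENNReal.ofReal '' {R : ℝ | 0 < R ∧ C.AchievableRate φ A R})

/-- The operational deterministic identification capacity in the double-exponential scale. -/
noncomputable def diCapacityDoubleExp {X Y : Type*} [Fintype Y] (C : DMC X Y) (φ : X → ℝ)
    (A : ℝ) : ℝ≥0∞ :=
  sSup (ENNReal.ofReal '' {R : ℝ | 0 < R ∧ C.AchievableRateDoubleExp φ A R})

end DMC

/-- The Shannon entropy in bits, `H(X) = -∑ x, p(x) log₂ p(x)`, with `0 log 0 = 0`. -/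
noncomputable def entropyBits {X : Type*} [Fintype X] (p : X → ℝ) : ℝ :=
  -∑ x, p x * Real.logb 2 (p x)

namespace DMC

/-- The values `H(X)`, where `X` ranges over the random inputs of the channel, `X ∼ p` for a
probability mass function `p` on the input alphabet, with `E[φ(X)] ≤ A`. -/
def inputEntropies {X Y : Type*} [Fintype X] [Fintype Y] (_C : DMC X Y) (φ : X → ℝ)
    (A : ℝ) : Set ℝ :=
  {h | ∃ p ∈ stdSimplex ℝ X, ∑ x, p x * φ x ≤ A ∧ entropyBits p = h}

/-- Two letters are equivalent iff their rows of the channel matrix are identical. -/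
def rowSetoid {X Y : Type*} [Fintype Y] (C : DMC X Y) : Setoid X where
  r x x' := ∀ y, C.W x y = C.W x' y
  iseqv := ⟨fun _ _ => rfl, fun h y => (h y).symm, fun h h' y => (h y).trans (h' y)⟩

/-- `z` assigns to each class `ℓ` of identical rows a letter of `ℓ` of lowest cost in `ℓ`. -/
def IsRepresentative {X Y : Type*} [Fintype Y] (C : DMC X Y) (φ : X → ℝ)
    (z : Quotient C.rowSetoid → X) : Prop :=
  ∀ ℓ, Quotient.mk C.rowSetoid (z ℓ) = ℓ ∧
    ∀ x, Quotient.mk C.rowSetoid x = ℓ → φ (z ℓ) ≤ φ x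

/-- Lowest-cost representatives exist on a finite input alphabet. -/
theorem exists_isRepresentative {X Y : Type*} [Fintype X] [Fintype Y] (C : DMC X Y)
    (φ : X → ℝ) : ∃ z, C.IsRepresentative φ z := by
  have h : ∀ ℓ : Quotient C.rowSetoid, ∃ a : X, Quotient.mk C.rowSetoid a = ℓ ∧
      ∀ x, Quotient.mk C.rowSetoid x = ℓ → φ a ≤ φ x := fun ℓ =>
    Set.exists_min_image {x | Quotient.mk C.rowSetoid x = ℓ} φ (Set.toFinite _)
      (Quotient.exists_rep ℓ)
  choose z hz using h
  exact ⟨z, hz⟩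

open Classical in
/-- The reduced input alphabet `{z(ℓ)}`. -/
noncomputable def reducedAlphabet {X Y : Type*} [Fintype X] [Fintype Y] (C : DMC X Y)
    (z : Quotient C.rowSetoid → X) : Finset X :=
  {x | ∃ ℓ, z ℓ = x}

/-- The reduced channel: the rows of `C` with index in the reduced input alphabet. -/
noncomputable def reduced {X Y : Type*} [Fintype X] [Fintype Y] (C : DMC X Y)
    (z : Quotient C.rowSetoid → X) : DMC (C.reducedAlphabet z) Y where
  W x y := C.W x y
  nonneg x y := C.nonneg x y
  sum_eq_one x := C.sum_eq_one x

end DMC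

/-! Converse: words that agree letter by letter up to row equivalence have the same output law, so
two codewords of this kind would force `l₁ + l₂ ≥ 1`. Replacing each letter by its representative is
therefore injective on codewords and does not raise the cost (`card_le_of_diCode`). The number of
messages is at most the number of admissible words over the reduced alphabet, and counting by types
(`card_seqCost_le`) bounds it by a polynomial times `2^(n h)`, with `h` the maximal entropy. This
bound is only singly exponential, so the double-exponential capacity vanishes as well.

Achievability: decoding regions may overlap, so each codeword needs only a test of its own law
against each other codeword's law. Two words whose rows have squared Euclidean distance linear in
`n` are separated by a sum of independent bounded scores, with exponentially small errors
(`exists_diCode_of_separated`). Distinct letters of the reduced alphabet have distinct rows, so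
balls of small linear radius have arbitrarily small exponential volume (`exists_ball_volume`). A
maximal separated subset of a typical set of about `2^(n H(p))` words (`exists_typical_set`,
`exists_separated_subset`) thus loses arbitrarily little rate. -/

/-! ### Concentration for product laws. -/

section ProductLaw

/-- The total mass of a product of weights. -/
theorem sum_prod_eq_prod_sum {Y : Type*} [Fintype Y] {n : ℕ} (q : Fin n → Y → ℝ) :
    ∑ y : Fin n → Y, ∏ t, q t (y t) = ∏ t, ∑ b, q t b := by
  classical
  rw [Finset.prod_univ_sum, Fintype.piFinset_univ]

open Classical in
/-- Chernoff bound for a sum of independent, centred, bounded variables. -/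
theorem prod_law_tail_centred {Y : Type*} [Fintype Y] {n : ℕ} (q g : Fin n → Y → ℝ)
    (hq : ∀ t b, 0 ≤ q t b) (hq₁ : ∀ t, ∑ b, q t b = 1) (hg : ∀ t, ∑ b, q t b * g t b = 0)
    {B l δ : ℝ} (hl : 0 ≤ l) (hB : ∀ t b, |g t b| ≤ B) (hlB : l * B ≤ 1) :
    ∑ y : Fin n → Y with n * δ ≤ ∑ t, g t (y t), ∏ t, q t (y t)
      ≤ Real.exp (-(n * (l * δ - (l * B) ^ 2))) := by
  have hprod : ∀ y : Fin n → Y, 0 ≤ ∏ t, q t (y t) := fun y =>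
    Finset.prod_nonneg fun t _ => hq t _
  -- For `|v| ≤ 1`, `exp v ≤ 1 + v + v ^ 2`; centring removes the linear term.
  have hmgf : ∀ t, ∑ b, q t b * Real.exp (l * g t b) ≤ Real.exp ((l * B) ^ 2) := by
    intro t
    have hterm : ∀ b, q t b * Real.exp (l * g t b) ≤
        q t b + l * (q t b * g t b) + (l * B) ^ 2 * q t b := by
      intro b
      have habs : |l * g t b| ≤ l * B := by
        rw [abs_mul, abs_of_nonneg hl]
        exact mul_le_mul_of_nonneg_left (hB t b) hl
      have h1 := (abs_le.mp (Real.abs_exp_sub_one_sub_id_le (habs.trans hlB))).2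
      have h2 : (l * g t b) ^ 2 ≤ (l * B) ^ 2 := sq_le_sq' (abs_le.mp habs).1 (abs_le.mp habs).2
      calc q t b * Real.exp (l * g t b)
          ≤ q t b * (1 + l * g t b + (l * B) ^ 2) :=
            mul_le_mul_of_nonneg_left (by linarith) (hq t b)
        _ = _ := by ring
    calc ∑ b, q t b * Real.exp (l * g t b)
        ≤ ∑ b, (q t b + l * (q t b * g t b) + (l * B) ^ 2 * q t b) :=
          Finset.sum_le_sum fun b _ => hterm b
      _ = (l * B) ^ 2 + 1 := by
          rw [Finset.sum_add_distrib, Finset.sum_add_distrib, ← Finset.mul_sum,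
            ← Finset.mul_sum, hq₁, hg]
          ring
      _ ≤ _ := Real.add_one_le_exp _
  calc ∑ y : Fin n → Y with n * δ ≤ ∑ t, g t (y t), ∏ t, q t (y t)
      ≤ ∑ y : Fin n → Y with n * δ ≤ ∑ t, g t (y t),
          Real.exp (-(l * (n * δ))) * ∏ t, q t (y t) * Real.exp (l * g t (y t)) := by
        refine Finset.sum_le_sum fun y hy => ?_
        have hy' := (Finset.mem_filter.mp hy).2
        rw [Finset.prod_mul_distrib, ← Real.exp_sum, ← Finset.mul_sum, mul_left_comm,
          ← Real.exp_add]
        refine le_mul_of_one_le_right (hprod y) (Real.one_le_exp ?_)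
        nlinarith [mul_le_mul_of_nonneg_left hy' hl]
    _ ≤ ∑ y : Fin n → Y,
          Real.exp (-(l * (n * δ))) * ∏ t, q t (y t) * Real.exp (l * g t (y t)) := by
        refine Finset.sum_le_sum_of_subset_of_nonneg (Finset.filter_subset _ _) fun y _ _ => ?_
        exact mul_nonneg (Real.exp_pos _).le
          (Finset.prod_nonneg fun t _ => mul_nonneg (hq t _) (Real.exp_pos _).le)
    _ = Real.exp (-(l * (n * δ))) * ∏ t, ∑ b, q t b * Real.exp (l * g t b) := by
        rw [← Finset.mul_sum, sum_prod_eq_prod_sum fun t b => q t b * Real.exp (l * g t b)]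
    _ ≤ Real.exp (-(l * (n * δ))) * ∏ _t : Fin n, Real.exp ((l * B) ^ 2) := by
        refine mul_le_mul_of_nonneg_left (Finset.prod_le_prod (fun t _ => ?_) fun t _ => hmgf t)
          (Real.exp_pos _).le
        exact Finset.sum_nonneg fun b _ => mul_nonneg (hq t b) (Real.exp_pos _).le
    _ = _ := by
        rw [Finset.prod_const, Finset.card_univ, Fintype.card_fin, ← Real.exp_nat_mul,
          ← Real.exp_add]
        congr 1
        ring

open Classical in
/-- Exponential concentration, uniform in the block length and the law, of sums of independent
variables with values in `[-B, B]`. -/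
theorem exists_prod_law_tail {B δ : ℝ} (hδ : 0 < δ) :
    ∃ c : ℝ, 0 < c ∧ ∀ {Y : Type*} [Fintype Y] {n : ℕ} (q f : Fin n → Y → ℝ),
      (∀ t b, 0 ≤ q t b) → (∀ t, ∑ b, q t b = 1) → (∀ t b, |f t b| ≤ B) →
      ∑ y : Fin n → Y with ∑ t, ∑ b, q t b * f t b + n * δ ≤ ∑ t, f t (y t), ∏ t, q t (y t)
        ≤ Real.exp (-(n * c)) := by
  -- `2 * |B|` bounds the centred variables, `1` keeps `K` away from zero, and `δ` ensures `l * K ≤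
  -- 1` for the `l` below, which maximises `l * δ - (l * K) ^ 2`.
  set K : ℝ := 2 * |B| + 1 + δ with hK
  have hK1 : 1 ≤ K := by have := abs_nonneg B; linarith
  have hKδ : δ ≤ K := by have := abs_nonneg B; linarith
  set l : ℝ := δ / (2 * K ^ 2) with hl
  have hl0 : 0 < l := by positivity
  have hlK : l * K ≤ 1 := by
    rw [hl, div_mul_eq_mul_div, div_le_one (by positivity)]
    nlinarith
  have hval : l * δ - (l * K) ^ 2 = δ ^ 2 / (4 * K ^ 2) := by
    rw [hl]; field_simp; ring
  refine ⟨l * δ - (l * K) ^ 2, by rw [hval]; positivity, ?_⟩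
  intro Y _ n q f hq hq₁ hf
  set g : Fin n → Y → ℝ := fun t b => f t b - ∑ b', q t b' * f t b' with hg
  have hE : ∀ t, |∑ b', q t b' * f t b'| ≤ |B| := by
    intro t
    calc |∑ b', q t b' * f t b'| ≤ ∑ b', |q t b' * f t b'| := Finset.abs_sum_le_sum_abs _ _
      _ ≤ ∑ b', q t b' * |B| := by
          refine Finset.sum_le_sum fun b _ => ?_
          rw [abs_mul, abs_of_nonneg (hq t b)]
          exact mul_le_mul_of_nonneg_left ((hf t b).trans (le_abs_self B)) (hq t b)
      _ = |B| := by rw [← Finset.sum_mul, hq₁, one_mul]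
  have hgK : ∀ t b, |g t b| ≤ K := by
    intro t b
    have h1 := abs_sub (f t b) (∑ b', q t b' * f t b')
    have h2 := hf t b
    have h3 := hE t
    have h4 := le_abs_self B
    simp only [hg]
    linarith
  have hg0 : ∀ t, ∑ b, q t b * g t b = 0 := by
    intro t
    simp only [hg, mul_sub, Finset.sum_sub_distrib]
    rw [← Finset.sum_mul, hq₁, one_mul, sub_self]
  have key := prod_law_tail_centred q g hq hq₁ hg0 (δ := δ) hl0.le hgK hlK
  refine le_of_eq_of_le
    (Finset.sum_congr (Finset.filter_congr fun y _ => ?_) fun _ _ => rfl) key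
  simp only [hg, Finset.sum_sub_distrib]
  constructor <;> intro h <;> linarith

end ProductLaw

/-! ### Separated sets and volumes of balls. -/

section Packing

open Classical in
/-- A finite set `G` in which the relation `r` has neighbourhoods of size at most `b` contains
`r`-separated sets of size at least `#G / b`. -/
theorem exists_separated_subset {V : Type*} [Fintype V] (G : Finset V) (r : V → V → Prop)
    (hr : ∀ v, r v v) (hsymm : ∀ v w, r v w → r w v) {b : ℝ}
    (hb : ∀ v, ((Finset.univ.filter (r v)).card : ℝ) ≤ b) :
    ∃ S ⊆ G, (∀ v ∈ S, ∀ w ∈ S, v ≠ w → ¬ r v w) ∧ (G.card : ℝ) ≤ S.card * b := by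
  have hne : (G.powerset.filter fun S => ∀ v ∈ S, ∀ w ∈ S, v ≠ w → ¬ r v w).Nonempty :=
    ⟨∅, by simp⟩
  obtain ⟨S, hS, hmax⟩ := Finset.exists_max_image _ Finset.card hne
  simp only [Finset.mem_filter, Finset.mem_powerset] at hS hmax
  refine ⟨S, hS.1, hS.2, ?_⟩
  -- A point outside all neighbourhoods could be added to `S`, against maximality.
  have hcover : G ⊆ S.biUnion fun v => Finset.univ.filter (r v) := by
    intro w hw
    by_contra hnot
    simp only [Finset.mem_biUnion, Finset.mem_filter, Finset.mem_univ, true_and, not_exists,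
      not_and] at hnot
    have hwS : w ∉ S := fun h => hnot w h (hr w)
    have := hmax (insert w S) ⟨Finset.insert_subset hw hS.1, ?_⟩
    · rw [Finset.card_insert_of_notMem hwS] at this
      omega
    · intro v hv v' hv' hvv'
      rcases Finset.mem_insert.mp hv with hvw | hvS <;>
        rcases Finset.mem_insert.mp hv' with hvw' | hvS'
      · exact absurd (hvw.trans hvw'.symm) hvv'
      · exact hvw ▸ fun h => hnot v' hvS' (hsymm _ _ h)
      · exact hvw' ▸ hnot v hvS
      · exact hS.2 v hvS v' hvS' hvv'
  calc (G.card : ℝ) ≤ ((S.biUnion fun v => Finset.univ.filter (r v)).card : ℝ) := by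
        exact_mod_cast Finset.card_le_card hcover
    _ ≤ ∑ v ∈ S, ((Finset.univ.filter (r v)).card : ℝ) := by
        exact_mod_cast Finset.card_biUnion_le
    _ ≤ ∑ _v ∈ S, b := Finset.sum_le_sum fun v _ => hb v
    _ = _ := by rw [Finset.sum_const, nsmul_eq_mul]

open Classical in
/-- For an additive distortion that separates letters, balls of small radius have a volume of
small exponential rate. -/
theorem exists_ball_volume {X : Type*} [Fintype X] (d : X → X → ℝ)
    (hd : ∀ a, d a a = 0) (hpos : ∀ a b, a ≠ b → 0 < d a b) {δ : ℝ} (hδ : 0 < δ) :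
    ∃ ε : ℝ, 0 < ε ∧ ∀ (n : ℕ) (x : Fin n → X),
      ((Finset.univ.filter fun x' : Fin n → X => ∑ t, d (x t) (x' t) ≤ n * ε).card : ℝ)
        ≤ Real.exp (n * δ) := by
  -- Only the term `b = a` survives, because `d` separates letters.
  have hlim : ∀ a, Tendsto (fun l : ℝ => ∑ b, Real.exp (-(l * d a b))) atTop (nhds 1) := by
    intro a
    have h : Tendsto (fun l : ℝ => ∑ b, Real.exp (-(l * d a b))) atTop
        (nhds (∑ b, if a = b then 1 else 0)) := by
      refine tendsto_finsetSum _ fun b _ => ?_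
      by_cases hab : a = b
      · subst hab
        simp [hd]
      · simp only [hab, if_false]
        exact Real.tendsto_exp_neg_atTop_nhds_zero.comp
          (tendsto_id.atTop_mul_const (hpos a b hab))
    simpa using h
  have hev : ∀ᶠ l : ℝ in atTop, 0 < l ∧ ∀ a, ∑ b, Real.exp (-(l * d a b)) ≤ Real.exp (δ / 2) :=
    (eventually_gt_atTop 0).and (eventually_all.mpr fun a =>
      (hlim a).eventually_le_const (Real.one_lt_exp_iff.mpr (half_pos hδ)))
  obtain ⟨l, hl, hle⟩ := hev.exists
  -- This radius makes the exponential Markov factor `exp (n * (δ / 2))`; the other half of `δ` pays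
  -- for the `n` sums over letters.
  refine ⟨δ / 2 / l, by positivity, fun n x => ?_⟩
  calc ((Finset.univ.filter fun x' : Fin n → X =>
          ∑ t, d (x t) (x' t) ≤ n * (δ / 2 / l)).card : ℝ)
      = ∑ x' : Fin n → X with ∑ t, d (x t) (x' t) ≤ n * (δ / 2 / l), (1 : ℝ) := by simp
    _ ≤ ∑ x' : Fin n → X with ∑ t, d (x t) (x' t) ≤ n * (δ / 2 / l),
          Real.exp (n * (δ / 2)) * ∏ t, Real.exp (-(l * d (x t) (x' t))) := by
        refine Finset.sum_le_sum fun x' hx' => ?_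
        rw [← Real.exp_sum, ← Real.exp_add, Finset.sum_neg_distrib, ← Finset.mul_sum]
        refine Real.one_le_exp ?_
        have h := mul_le_mul_of_nonneg_left (Finset.mem_filter.mp hx').2 hl.le
        have : l * (n * (δ / 2 / l)) = n * (δ / 2) := by field_simp
        linarith
    _ ≤ ∑ x' : Fin n → X,
          Real.exp (n * (δ / 2)) * ∏ t, Real.exp (-(l * d (x t) (x' t))) :=
        Finset.sum_le_sum_of_subset_of_nonneg (Finset.filter_subset _ _) fun y _ _ => by positivity
    _ = Real.exp (n * (δ / 2)) * ∏ t, ∑ b, Real.exp (-(l * d (x t) b)) := by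
        rw [← Finset.mul_sum, sum_prod_eq_prod_sum fun t b => Real.exp (-(l * d (x t) b))]
    _ ≤ Real.exp (n * (δ / 2)) * ∏ _t : Fin n, Real.exp (δ / 2) := by
        gcongr with t _
        exact hle _
    _ = Real.exp (n * δ) := by
        rw [Finset.prod_const, Finset.card_univ, Fintype.card_fin, ← Real.exp_nat_mul,
          ← Real.exp_add]
        congr 1
        ring

end Packing

/-! ### Typical words under a cost constraint. -/

section Typical

open Classical in
-- A one-sided weak law of large numbers: on a finite alphabet every `f` is bounded by `∑ a, |f a|`,
-- so the uniform tail bound applies. It also serves for `log p`, since `Real.log 0 = 0` keeps that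
-- function finite.
theorem eventually_iid_tail_le {X : Type*} [Fintype X] {p : X → ℝ} (hp : p ∈ stdSimplex ℝ X)
    (f : X → ℝ) {δ ε : ℝ} (hδ : 0 < δ) (hε : 0 < ε) :
    ∀ᶠ n : ℕ in atTop,
      ∑ x : Fin n → X with n * (∑ a, p a * f a + δ) ≤ ∑ t, f (x t), ∏ t, p (x t) ≤ ε := by
  obtain ⟨c, hc, h⟩ := exists_prod_law_tail (B := ∑ a, |f a|) hδ
  have hlim : Tendsto (fun n : ℕ => Real.exp (-(n * c))) atTop (nhds 0) :=
    Real.tendsto_exp_neg_atTop_nhds_zero.comp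
      (tendsto_natCast_atTop_atTop.atTop_mul_const hc)
  filter_upwards [hlim.eventually_le_const hε] with n hn
  refine (le_of_eq_of_le (Finset.sum_congr (Finset.filter_congr fun x _ => ?_) fun _ _ => rfl)
    (h (fun (_ : Fin n) a => p a) (fun _ a => f a) (fun _ a => hp.1 a) (fun _ => hp.2)
      fun _ a => Finset.single_le_sum (f := fun a => |f a|) (fun _ _ => abs_nonneg _)
        (Finset.mem_univ a))).trans hn
  simp only [Finset.sum_const, Finset.card_univ, Fintype.card_fin, nsmul_eq_mul, mul_add]

theorem seqCost_le_iff {X : Type*} (φ : X → ℝ) {n : ℕ} (hn : 0 < n) (x : Fin n → X) (A : ℝ) :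
    seqCost φ x ≤ A ↔ ∑ t, φ (x t) ≤ n * A := by
  have : (0 : ℝ) < n := Nat.cast_pos.mpr hn
  rw [seqCost, one_div, inv_mul_le_iff₀ this]

/-- Sequences that satisfy the cost constraint and have an almost constant empirical mean of `f`
are at least as many as the entropy of an admissible input law says. -/
theorem exists_typical_set {X : Type*} [Fintype X] {p : X → ℝ} (hp : p ∈ stdSimplex ℝ X)
    {φ : X → ℝ} {A : ℝ} (hA : ∑ a, p a * φ a < A ∨ ∀ a, p a ≠ 0 → φ a ≤ A)
    (f : X → ℝ) {δ η : ℝ} (hδ : 0 < δ) (hη : 0 < η) :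
    ∀ᶠ n : ℕ in atTop, ∃ G : Finset (Fin n → X), (∀ x ∈ G, seqCost φ x ≤ A) ∧
      (∀ x ∈ G, |∑ t, f (x t) - n * ∑ a, p a * f a| ≤ n * η) ∧
      1 / 2 * Real.exp (n * (∑ a, Real.negMulLog (p a) - δ)) ≤ G.card := by
  classical
  -- With strict slack in the mean cost this is the law of large numbers. Without slack the second
  -- alternative makes every word of positive weight admissible.
  have hcost : ∀ᶠ n : ℕ in atTop,
      ∑ x : Fin n → X with ¬ ∑ t, φ (x t) ≤ n * A, ∏ t, p (x t) ≤ 1 / 8 := by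
    rcases hA with hA | hA
    · filter_upwards [eventually_iid_tail_le hp φ (sub_pos.mpr hA)
        (by norm_num : (0 : ℝ) < 1 / 8)] with n hn
      refine le_trans (Finset.sum_le_sum_of_subset_of_nonneg (fun x hx => ?_) fun x _ _ =>
        Finset.prod_nonneg fun t _ => hp.1 _) hn
      simp only [Finset.mem_filter, Finset.mem_univ, true_and, not_le] at hx ⊢
      rw [add_sub_cancel]
      exact hx.le
    · refine Eventually.of_forall fun n => ?_
      rw [Finset.sum_eq_zero]
      · norm_num
      · intro x hx
        by_contra hne
        refine (Finset.mem_filter.mp hx).2 ?_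
        calc ∑ t, φ (x t) ≤ ∑ _t : Fin n, A :=
              Finset.sum_le_sum fun t _ => hA _ fun h0 =>
                hne (Finset.prod_eq_zero (Finset.mem_univ t) h0)
          _ = n * A := by simp
  have h8 : (0 : ℝ) < 1 / 8 := by norm_num
  -- Four exceptional events of weight at most `1 / 8` each leave weight at least `1 / 2` for `G`.
  filter_upwards [hcost, eventually_iid_tail_le hp f hη h8,
    eventually_iid_tail_le hp (fun a => -f a) hη h8,
    eventually_iid_tail_le hp (fun a => Real.log (p a)) hδ h8, eventually_gt_atTop 0]
    with n h1 h2 h3 h4 hn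
  set w : (Fin n → X) → ℝ := fun x => ∏ t, p (x t) with hw
  have hw0 : ∀ x, 0 ≤ w x := fun x => Finset.prod_nonneg fun t _ => hp.1 _
  have hw1 : ∑ x, w x = 1 := by
    simp only [hw]
    rw [sum_prod_eq_prod_sum fun (_ : Fin n) a => p a]
    simp [hp.2]
  set G : Finset (Fin n → X) := Finset.univ.filter fun x =>
    ∑ t, φ (x t) ≤ n * A ∧ |∑ t, f (x t) - n * ∑ a, p a * f a| ≤ n * η ∧
      ∑ t, Real.log (p (x t)) ≤ n * (∑ a, p a * Real.log (p a) + δ) with hG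
  have hmass : 1 / 2 ≤ ∑ x ∈ G, w x := by
    -- The union bound, written pointwise with indicators.
    have hsplit : ∑ x, w x ≤ ∑ x, ((if ∑ t, φ (x t) ≤ n * A ∧
        |∑ t, f (x t) - n * ∑ a, p a * f a| ≤ n * η ∧
        ∑ t, Real.log (p (x t)) ≤ n * (∑ a, p a * Real.log (p a) + δ) then w x else 0) +
        (if ¬ ∑ t, φ (x t) ≤ n * A then w x else 0) +
        (if n * (∑ a, p a * f a + η) ≤ ∑ t, f (x t) then w x else 0) +
        (if n * (∑ a, p a * -f a + η) ≤ ∑ t, -f (x t) then w x else 0) +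
        (if n * (∑ a, p a * Real.log (p a) + δ) ≤ ∑ t, Real.log (p (x t)) then w x else 0)) := by
      refine Finset.sum_le_sum fun x _ => ?_
      have hwx := hw0 x
      by_cases c1 : ∑ t, φ (x t) ≤ n * A
      swap
      · rw [if_pos c1]
        have := fun (P : Prop) [Decidable P] => (ite_nonneg hwx le_rfl :
          0 ≤ if P then w x else 0)
        linarith [this (∑ t, φ (x t) ≤ n * A ∧
          |∑ t, f (x t) - n * ∑ a, p a * f a| ≤ n * η ∧
          ∑ t, Real.log (p (x t)) ≤ n * (∑ a, p a * Real.log (p a) + δ)),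
          this (n * (∑ a, p a * f a + η) ≤ ∑ t, f (x t)),
          this (n * (∑ a, p a * -f a + η) ≤ ∑ t, -f (x t)),
          this (n * (∑ a, p a * Real.log (p a) + δ) ≤ ∑ t, Real.log (p (x t)))]
      by_cases c2 : n * (∑ a, p a * f a + η) ≤ ∑ t, f (x t)
      · rw [if_pos c2]
        split_ifs <;> linarith
      by_cases c3 : n * (∑ a, p a * -f a + η) ≤ ∑ t, -f (x t)
      · rw [if_pos c3]
        split_ifs <;> linarith
      by_cases c4 : n * (∑ a, p a * Real.log (p a) + δ) ≤ ∑ t, Real.log (p (x t))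
      · rw [if_pos c4]
        split_ifs <;> linarith
      rw [if_pos]
      · split_ifs
        linarith
      · refine ⟨c1, abs_le.mpr ⟨?_, ?_⟩, (not_le.mp c4).le⟩
        · simp only [mul_neg, Finset.sum_neg_distrib] at c3
          linarith
        · linarith
    simp only [Finset.sum_add_distrib, ← Finset.sum_filter] at hsplit
    rw [hw1] at hsplit
    linarith
  have hprob : ∀ x ∈ G, w x ≤ Real.exp (-(n * (∑ a, Real.negMulLog (p a) - δ))) := by
    intro x hx
    -- The product is the exponential of the sum of logarithms only if no letter has weight zero;
    -- otherwise the word has weight zero.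
    by_cases h0 : ∃ t, p (x t) = 0
    · obtain ⟨t, ht⟩ := h0
      have : w x = 0 := Finset.prod_eq_zero (Finset.mem_univ t) ht
      rw [this]
      exact (Real.exp_pos _).le
    · push Not at h0
      have : w x = Real.exp (∑ t, Real.log (p (x t))) := by
        rw [Real.exp_sum]
        exact Finset.prod_congr rfl fun t _ =>
          (Real.exp_log ((hp.1 _).lt_of_ne (h0 t).symm)).symm
      rw [this, Real.exp_le_exp]
      have h := (Finset.mem_filter.mp hx).2.2.2
      simp only [Real.negMulLog, neg_mul, Finset.sum_neg_distrib]
      linarith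
  refine ⟨G, fun x hx => (seqCost_le_iff φ hn x A).mpr (Finset.mem_filter.mp hx).2.1,
    fun x hx => (Finset.mem_filter.mp hx).2.2.1, ?_⟩
  have hcard := hmass.trans (Finset.sum_le_card_nsmul G w _ hprob)
  rw [nsmul_eq_mul, Real.exp_neg, ← div_eq_mul_inv, le_div_iff₀ (Real.exp_pos _)] at hcard
  exact hcard

end Typical

namespace DMC

/-! ### Identification tests from row distances. -/

section Decoding

variable {X Y : Type*} [Fintype Y] (C : DMC X Y)

/-- The squared Euclidean length of a row. -/
noncomputable def rowNormSq (a : X) : ℝ := ∑ y, C.W a y ^ 2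

/-- The squared Euclidean distance of two rows. -/
noncomputable def rowDistSq (a b : X) : ℝ := ∑ y, (C.W a y - C.W b y) ^ 2

/-- The score of an output letter in the identification test for an input letter. -/
noncomputable def score (a : X) (y : Y) : ℝ := 2 * C.W a y - C.rowNormSq a

theorem rowDistSq_self (a : X) : C.rowDistSq a a = 0 := by simp [rowDistSq]

theorem rowDistSq_comm (a b : X) : C.rowDistSq a b = C.rowDistSq b a :=
  Finset.sum_congr rfl fun y _ => by ring

theorem rowDistSq_pos (hinj : Function.Injective C.W) (a b : X) (hab : a ≠ b) :
    0 < C.rowDistSq a b := by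
  obtain ⟨y, hy⟩ := Function.ne_iff.mp (hinj.ne hab)
  exact Finset.sum_pos' (fun _ _ => sq_nonneg _)
    ⟨y, Finset.mem_univ y, sq_pos_of_ne_zero (sub_ne_zero.mpr hy)⟩

theorem W_le_one (a : X) (y : Y) : C.W a y ≤ 1 :=
  C.sum_eq_one a ▸ Finset.single_le_sum (f := C.W a) (fun y _ => C.nonneg a y) (Finset.mem_univ y)

theorem rowNormSq_le_one (a : X) : C.rowNormSq a ≤ 1 :=
  C.sum_eq_one a ▸ Finset.sum_le_sum fun y _ =>
    pow_le_of_le_one (C.nonneg a y) (C.W_le_one a y) two_ne_zero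

theorem abs_score_le (a : X) (y : Y) : |C.score a y| ≤ 2 := by
  have h1 := C.W_le_one a y
  have h2 := C.nonneg a y
  have h3 := C.rowNormSq_le_one a
  have h4 : 0 ≤ C.rowNormSq a := Finset.sum_nonneg fun _ _ => sq_nonneg _
  rw [score, abs_le]
  constructor <;> linarith

/-- Completing the square. Under the row of `b`, testing for a wrong letter `a` lowers the mean
score by exactly the squared row distance. -/
theorem sum_mul_score (a b : X) :
    ∑ y, C.W b y * C.score a y = C.rowNormSq b - C.rowDistSq a b := by
  have h : ∑ y, C.W b y * C.score a y = ∑ y, 2 * (C.W a y * C.W b y) - C.rowNormSq a := by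
    simp only [score, mul_sub, Finset.sum_sub_distrib]
    rw [← Finset.sum_mul, C.sum_eq_one, one_mul]
    congr 1
    exact Finset.sum_congr rfl fun y _ => by ring
  rw [h, rowNormSq, rowNormSq, rowDistSq, ← Finset.sum_sub_distrib, ← Finset.sum_sub_distrib]
  exact Finset.sum_congr rfl fun y _ => by ring

theorem prob_mono {n : ℕ} {D E : Set (Fin n → Y)} (h : D ⊆ E) (x : Fin n → X) :
    C.prob D x ≤ C.prob E x := by
  refine Finset.sum_le_sum_of_subset_of_nonneg (fun y hy => ?_)
    fun _ _ _ => Finset.prod_nonneg fun _ _ => C.nonneg _ _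
  simp only [Finset.mem_filter, Finset.mem_univ, true_and] at hy ⊢
  exact h hy

/-- Words whose rows are far apart, with almost equal sums of squared row lengths, are the
codewords of an identification code. -/
theorem exists_diCode_of_separated {η l₁ l₂ : ℝ} (hη : 0 < η) (hl₁ : 0 < l₁) (hl₂ : 0 < l₂)
    (φ : X → ℝ) (A m : ℝ) :
    ∀ᶠ n : ℕ in atTop, ∀ (M : ℕ) (u : Fin M → Fin n → X), (∀ i, seqCost φ (u i) ≤ A) →
      (∀ i, |∑ t, C.rowNormSq (u i t) - n * m| ≤ n * η) →
      (∀ i j, i ≠ j → n * (4 * η) < ∑ t, C.rowDistSq (u i t) (u j t)) →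
      Nonempty (DICode C φ A M n l₁ l₂) := by
  obtain ⟨c, hc, h⟩ := exists_prod_law_tail (B := 2) hη
  have hlim : Tendsto (fun n : ℕ => Real.exp (-(n * c))) atTop (nhds 0) :=
    Real.tendsto_exp_neg_atTop_nhds_zero.comp
      (tendsto_natCast_atTop_atTop.atTop_mul_const hc)
  filter_upwards [hlim.eventually_le_const hl₁, hlim.eventually_le_const hl₂]
    with n hn₁ hn₂ M u hcost hnorm hdist
  -- Per letter, the mean score is at least `m - η` for the own codeword and below `m + η - 4 * η =
  -- m - 3 * η` for another; the threshold lies at least `η` from both.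
  refine ⟨⟨u, fun i => {y | n * (m - 2 * η) < ∑ t, C.score (u i t) (y t)}, hcost,
    fun i => ?_, fun i j hij => ?_⟩⟩
  · have htail : C.prob {y | ∑ t, ∑ b, C.W (u i t) b * -C.score (u i t) b + n * η ≤
        ∑ t, -C.score (u i t) (y t)} (u i) ≤ Real.exp (-(n * c)) :=
      h (fun t => C.W (u i t)) (fun t y => -C.score (u i t) y)
      (fun t => C.nonneg _) (fun t => C.sum_eq_one _) fun t y => by
        rw [abs_neg]; exact C.abs_score_le _ _
    refine le_trans (C.prob_mono (fun y hy => ?_) (u i)) (htail.trans hn₁)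
    have hy' : ∑ t, C.score (u i t) (y t) ≤ n * (m - 2 * η) := not_lt.mp hy
    change (_ : ℝ) ≤ _
    simp only [mul_neg, Finset.sum_neg_distrib, sum_mul_score, rowDistSq_self, sub_zero]
    linarith [(abs_le.mp (hnorm i)).1]
  · have htail : C.prob {y | ∑ t, ∑ b, C.W (u i t) b * C.score (u j t) b + n * η ≤
        ∑ t, C.score (u j t) (y t)} (u i) ≤ Real.exp (-(n * c)) :=
      h (fun t => C.W (u i t)) (fun t y => C.score (u j t) y)
      (fun t => C.nonneg _) (fun t => C.sum_eq_one _) fun t y => C.abs_score_le _ _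
    refine le_trans (C.prob_mono (fun y hy => ?_) (u i)) (htail.trans hn₂)
    have hy' : n * (m - 2 * η) < ∑ t, C.score (u j t) (y t) := hy
    change (_ : ℝ) ≤ _
    simp only [sum_mul_score, Finset.sum_sub_distrib]
    linarith [(abs_le.mp (hnorm i)).2, hdist j i hij.symm]

end Decoding

/-! ### Achievability for channels with distinct rows. -/

section Achievability

variable {X Y : Type*} [Fintype X] [Fintype Y] (C : DMC X Y)

theorem entropyBits_eq (p : X → ℝ) :
    entropyBits p = (∑ a, Real.negMulLog (p a)) / Real.log 2 := by
  simp only [entropyBits, Real.logb, Real.negMulLog, Finset.sum_div, ← Finset.sum_neg_distrib]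
  exact Finset.sum_congr rfl fun a _ => by ring

/-- A separated packing of the typical set of `p` loses only the exponent of a small ball. The
typical set is taken for `rowNormSq`, so that one threshold suits all codewords. -/
theorem achievableRate_of_lt_entropyBits (hinj : Function.Injective C.W) {φ : X → ℝ} {A R : ℝ}
    {p : X → ℝ} (hp : p ∈ stdSimplex ℝ X)
    (hA : ∑ a, p a * φ a < A ∨ ∀ a, p a ≠ 0 → φ a ≤ A) (hR : R < entropyBits p) :
    C.AchievableRate φ A R := by
  classical
  intro l₁ l₂ hl₁ hl₂
  have hlog : 0 < Real.log 2 := Real.log_pos one_lt_two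
  rw [entropyBits_eq, lt_div_iff₀ hlog] at hR
  set H := ∑ a, Real.negMulLog (p a)
  -- One `δ` is lost to typicality, one to the ball volume, and the remaining `2 * δ` absorb the
  -- factor `1 / 2`.
  set δ := (H - R * Real.log 2) / 4 with hδ
  have hδ0 : 0 < δ := by rw [hδ]; linarith
  obtain ⟨ε, hε, hball⟩ := exists_ball_volume C.rowDistSq C.rowDistSq_self
    (C.rowDistSq_pos hinj) hδ0
  have hη : 0 < ε / 4 := by positivity
  have hlarge : ∀ᶠ n : ℕ in atTop, 2 ≤ Real.exp (n * (2 * δ)) :=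
    (Real.tendsto_exp_atTop.comp (tendsto_natCast_atTop_atTop.atTop_mul_const
      (by positivity : 0 < 2 * δ))).eventually_ge_atTop 2
  filter_upwards [exists_typical_set hp hA C.rowNormSq hδ0 hη,
    C.exists_diCode_of_separated hη hl₁ hl₂ φ A (∑ a, p a * C.rowNormSq a), hlarge]
    with n ⟨G, hGcost, hGnorm, hGcard⟩ hcode hn
  obtain ⟨S, hSG, hsep, hcard⟩ := exists_separated_subset G
    (fun x x' => ∑ t, C.rowDistSq (x t) (x' t) ≤ n * ε)
    (fun x => by simp only [rowDistSq_self, Finset.sum_const_zero]; positivity)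
    (fun x x' h => by simpa only [C.rowDistSq_comm] using h) (hball n)
  have hsize : ⌈(2 : ℝ) ^ ((n : ℝ) * R)⌉₊ ≤ S.card := by
    refine Nat.ceil_le.mpr ?_
    rw [Real.rpow_def_of_pos two_pos]
    have h1 : 1 / 2 * Real.exp (n * (H - δ)) ≤ S.card * Real.exp (n * δ) := hGcard.trans hcard
    have h2 : Real.exp (n * (H - δ)) =
        Real.exp (Real.log 2 * (n * R)) * Real.exp (n * (2 * δ)) * Real.exp (n * δ) := by
      rw [← Real.exp_add, ← Real.exp_add]
      congr 1
      rw [hδ]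
      ring
    rw [h2, ← mul_assoc] at h1
    have h3 := le_of_mul_le_mul_right h1 (Real.exp_pos _)
    have h4 := mul_le_mul_of_nonneg_left hn (Real.exp_pos (Real.log 2 * (n * R))).le
    linarith
  set v : Fin ⌈(2 : ℝ) ^ ((n : ℝ) * R)⌉₊ → S := fun i => S.equivFin.symm (Fin.castLE hsize i)
    with hv
  have hvinj : Function.Injective v :=
    S.equivFin.symm.injective.comp (Fin.castLE_injective hsize)
  refine hcode _ (fun i => v i) (fun i => hGcost _ (hSG (v i).2))
    (fun i => hGnorm _ (hSG (v i).2)) fun i j hij => ?_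
  have := hsep _ (v i).2 _ (v j).2 fun h => hij (hvinj (Subtype.ext h))
  rw [mul_div_cancel₀ ε four_ne_zero]
  exact not_le.mp this

end Achievability

end DMC

/-! ### Counting words by types. -/

section Types

/-- The empirical distribution of a word. -/
noncomputable def empirical {X : Type*} [DecidableEq X] {n : ℕ} (x : Fin n → X) (a : X) : ℝ :=
  (Finset.univ.filter fun t => x t = a).card / n

theorem sum_eq_mul_sum_empirical {X : Type*} [Fintype X] [DecidableEq X] {n : ℕ} (hn : 0 < n)
    (x : Fin n → X) (f : X → ℝ) : ∑ t, f (x t) = n * ∑ a, empirical x a * f a := by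
  have hn' : (n : ℝ) ≠ 0 := by positivity
  rw [← Finset.sum_fiberwise Finset.univ x, Finset.mul_sum]
  refine Finset.sum_congr rfl fun a _ => ?_
  rw [Finset.sum_congr rfl fun t ht => by rw [(Finset.mem_filter.mp ht).2], Finset.sum_const,
    nsmul_eq_mul, empirical]
  field_simp

theorem empirical_mem_stdSimplex {X : Type*} [Fintype X] [DecidableEq X] {n : ℕ} (hn : 0 < n)
    (x : Fin n → X) : empirical x ∈ stdSimplex ℝ X := by
  refine ⟨fun a => div_nonneg (Nat.cast_nonneg _) (Nat.cast_nonneg _), ?_⟩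
  have h := sum_eq_mul_sum_empirical hn x fun _ => 1
  have hn' : (n : ℝ) ≠ 0 := by positivity
  simp only [mul_one, Finset.sum_const, Finset.card_univ, Fintype.card_fin, nsmul_eq_mul] at h
  exact (mul_left_cancel₀ hn' (h.symm.trans (mul_one _).symm))

theorem empirical_apply_pos {X : Type*} [DecidableEq X] {n : ℕ} (x : Fin n → X) (t : Fin n) :
    0 < empirical x (x t) := by
  have : 0 < n := t.pos
  have h : 0 < (Finset.univ.filter fun s => x s = x t).card :=
    Finset.card_pos.mpr ⟨t, by simp⟩
  rw [empirical]
  positivity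

/-- A type class has at most `exp (n H)` elements, where `H` is the entropy of the type. -/
theorem card_empirical_eq_le {X : Type*} [Fintype X] [DecidableEq X] {n : ℕ} (hn : 0 < n)
    (s : Finset (Fin n → X)) (p : X → ℝ) (hs : ∀ x ∈ s, empirical x = p) {H : ℝ}
    (hH : ∑ a, Real.negMulLog (p a) ≤ H) : (s.card : ℝ) ≤ Real.exp (n * H) := by
  rcases s.eq_empty_or_nonempty with rfl | ⟨x₀, hx₀⟩
  · simpa using (Real.exp_pos _).le
  have hp : p ∈ stdSimplex ℝ X := hs x₀ hx₀ ▸ empirical_mem_stdSimplex hn x₀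
  -- Under its own type a word has probability exactly `exp (-n H(p))`; occurring letters have
  -- positive empirical weight, so the logarithms are genuine.
  have hlow : ∀ x ∈ s, Real.exp (-(n * H)) ≤ ∏ t, p (x t) := by
    intro x hx
    have hprod : ∏ t, p (x t) = Real.exp (∑ t, Real.log (p (x t))) := by
      rw [Real.exp_sum]
      refine Finset.prod_congr rfl fun t _ => (Real.exp_log ?_).symm
      rw [← hs x hx]
      exact empirical_apply_pos x t
    rw [hprod, Real.exp_le_exp, sum_eq_mul_sum_empirical hn x fun a => Real.log (p a), hs x hx]
    simp only [Real.negMulLog, neg_mul, Finset.sum_neg_distrib] at hH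
    have := mul_le_mul_of_nonneg_left hH (Nat.cast_nonneg (α := ℝ) n)
    linarith
  have hsum : s.card * Real.exp (-(n * H)) ≤ 1 := by
    calc s.card * Real.exp (-(n * H)) = s.card • Real.exp (-(n * H)) := (nsmul_eq_mul _ _).symm
      _ ≤ ∑ x ∈ s, ∏ t, p (x t) := Finset.card_nsmul_le_sum s _ _ hlow
      _ ≤ ∑ x : Fin n → X, ∏ t, p (x t) :=
          Finset.sum_le_sum_of_subset_of_nonneg (Finset.subset_univ s) fun x _ _ =>
            Finset.prod_nonneg fun t _ => hp.1 _
      _ = 1 := by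
          rw [sum_prod_eq_prod_sum fun (_ : Fin n) a => p a]
          simp [hp.2]
  rwa [Real.exp_neg, ← div_eq_mul_inv, div_le_one (Real.exp_pos _)] at hsum

open Classical in
/-- The number of words that satisfy a cost constraint is governed by the largest entropy of an
admissible law. -/
theorem card_seqCost_le {X : Type*} [Fintype X] (φ : X → ℝ) (A : ℝ) {H : ℝ}
    (hH : ∀ p ∈ stdSimplex ℝ X, ∑ a, p a * φ a ≤ A → ∑ a, Real.negMulLog (p a) ≤ H)
    {n : ℕ} (hn : 0 < n) :
    ((Finset.univ.filter fun x : Fin n → X => seqCost φ x ≤ A).card : ℝ)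
      ≤ ((n : ℝ) + 1) ^ Fintype.card X * Real.exp (n * H) := by
  set S := Finset.univ.filter fun x : Fin n → X => seqCost φ x ≤ A with hS
  -- Integer counts determine the type and take at most `(n + 1) ^ Fintype.card X` values.
  let count : (Fin n → X) → X → Fin (n + 1) := fun x a =>
    ⟨(Finset.univ.filter fun t => x t = a).card, by
      simpa [Nat.lt_succ_iff] using Finset.card_filter_le Finset.univ fun t => x t = a⟩
  have hcount : ∀ x x', count x = count x' → empirical x = empirical x' := by
    intro x x' h
    funext a
    have := congrArg Fin.val (congrFun h a)
    simp only [count] at this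
    rw [empirical, empirical, this]
  have hfib : ∀ c, ((S.filter fun x => count x = c).card : ℝ) ≤ Real.exp (n * H) := by
    intro c
    rcases (S.filter fun x => count x = c).eq_empty_or_nonempty with h | ⟨x₀, hx₀⟩
    · rw [h]
      simpa using (Real.exp_pos _).le
    · have hx := Finset.mem_filter.mp hx₀
      refine card_empirical_eq_le hn _ (empirical x₀) (fun x hx' => hcount _ _
        ((Finset.mem_filter.mp hx').2.trans hx.2.symm)) (hH _ (empirical_mem_stdSimplex hn x₀) ?_)
      have hc := (seqCost_le_iff φ hn x₀ A).mp (Finset.mem_filter.mp hx.1).2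
      rw [sum_eq_mul_sum_empirical hn x₀ φ] at hc
      exact le_of_mul_le_mul_left hc (Nat.cast_pos.mpr hn)
  calc (S.card : ℝ) = ∑ c, ((S.filter fun x => count x = c).card : ℝ) := by
        exact_mod_cast Finset.card_eq_sum_card_fiberwise fun x _ => Finset.mem_univ (count x)
    _ ≤ ∑ _c : X → Fin (n + 1), Real.exp (n * H) := Finset.sum_le_sum fun c _ => hfib c
    _ = _ := by simp

end Types

/-! ### Output laws and passage to the reduced alphabet. -/

namespace DMC

theorem prob_compl_add_prob {X Y : Type*} [Fintype Y] (C : DMC X Y) {n : ℕ} (D : Set (Fin n → Y)) (x : Fin n → X) :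
    C.prob Dᶜ x + C.prob D x = 1 := by
  classical
  have h : ∑ y : Fin n → Y, C.seqProb x y = 1 := by
    simp only [seqProb]
    rw [sum_prod_eq_prod_sum fun t y => C.W (x t) y]
    simp [C.sum_eq_one]
  rw [← h, ← Finset.sum_filter_add_sum_filter_not Finset.univ (fun y => y ∈ D), add_comm]
  rw [prob, prob]
  congr!

theorem prob_congr {X Y : Type*} [Fintype Y] (C : DMC X Y) {n : ℕ} (D : Set (Fin n → Y)) {x x' : Fin n → X}
    (h : ∀ t, C.W (x t) = C.W (x' t)) : C.prob D x = C.prob D x' := by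
  simp only [prob, seqProb, h]

variable {X Y : Type*} [Fintype X] [Fintype Y] (C : DMC X Y)

section Reduction

variable (z : Quotient C.rowSetoid → X)

/-- The letter of the reduced alphabet that represents a given letter. -/
noncomputable def representative (x : X) : C.reducedAlphabet z :=
  ⟨z (Quotient.mk C.rowSetoid x), by simp [reducedAlphabet]⟩

variable {z} {φ : X → ℝ}

theorem W_representative (hz : C.IsRepresentative φ z) (x : X) :
    C.W (C.representative z x) = C.W x := by
  have h := Quotient.exact (s := C.rowSetoid) (hz (Quotient.mk C.rowSetoid x)).1
  exact funext h

theorem cost_representative_le (hz : C.IsRepresentative φ z) (x : X) :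
    φ (C.representative z x) ≤ φ x :=
  (hz (Quotient.mk C.rowSetoid x)).2 x rfl

/-- Each class contributes a single letter. This makes the row distance separate letters, as the
packing argument requires. -/
theorem reduced_W_injective (hz : C.IsRepresentative φ z) :
    Function.Injective (C.reduced z).W := by
  rintro ⟨a, ha⟩ ⟨b, hb⟩ hab
  simp only [reducedAlphabet, Finset.mem_filter, Finset.mem_univ, true_and] at ha hb
  obtain ⟨k, rfl⟩ := ha
  obtain ⟨l, rfl⟩ := hb
  have h : Quotient.mk C.rowSetoid (z k) = Quotient.mk C.rowSetoid (z l) :=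
    Quotient.sound (s := C.rowSetoid) (congrFun hab)
  rw [(hz k).1, (hz l).1] at h
  exact Subtype.ext (congrArg z h)

/-- The inclusion of the reduced alphabet preserves rows and costs, so the same codewords and
regions serve the full channel. -/
theorem AchievableSize.of_reduced {A : ℝ} {size : ℕ → ℕ}
    (h : (C.reduced z).AchievableSize (fun x => φ x) A size) : C.AchievableSize φ A size := by
  intro l₁ l₂ hl₁ hl₂
  filter_upwards [h l₁ l₂ hl₁ hl₂] with n ⟨c⟩
  exact ⟨⟨fun i t => c.u i t, c.D, c.cost_le, c.missed_le, c.false_le⟩⟩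

end Reduction

/-! ### The converse bound on code sizes. -/

section Converse

variable {z : Quotient C.rowSetoid → X} {φ : X → ℝ}

open Classical in
/-- Codewords of an identification code stay different in the reduced alphabet. -/
theorem card_le_of_diCode (hz : C.IsRepresentative φ z) {A : ℝ} {M n : ℕ} {l₁ l₂ : ℝ}
    (hl : l₁ + l₂ < 1) (c : DICode C φ A M n l₁ l₂) :
    M ≤ (Finset.univ.filter fun x : Fin n → C.reducedAlphabet z =>
      seqCost (fun a : C.reducedAlphabet z => φ a) x ≤ A).card := by
  -- If `i ≠ j` had the same image, `c.D j` would have one probability under both codewords, at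
  -- least `1 - l₁` and at most `l₂`.
  have hinj : Function.Injective fun i t => C.representative z (c.u i t) := by
    intro i j hij
    by_contra hne
    have hrow : ∀ t, C.W (c.u i t) = C.W (c.u j t) := fun t => by
      rw [← C.W_representative hz (c.u i t), ← C.W_representative hz (c.u j t)]
      exact congrArg (fun a : C.reducedAlphabet z => C.W a) (congrFun hij t)
    have h1 := C.prob_compl_add_prob (c.D j) (c.u j)
    have h2 := c.missed_le j
    have h3 := c.false_le i j hne
    rw [C.prob_congr _ hrow] at h3
    linarith
  calc M = (Finset.univ : Finset (Fin M)).card := by simp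
    _ ≤ _ := Finset.card_le_card_of_injOn _ (fun i _ => ?_) hinj.injOn
  refine Finset.mem_coe.mpr (Finset.mem_filter.mpr ⟨Finset.mem_univ _, le_trans ?_ (c.cost_le i)⟩)
  exact mul_le_mul_of_nonneg_left
    (Finset.sum_le_sum fun t _ => C.cost_representative_le hz (c.u i t)) (by positivity)

/-- Achievable code sizes grow at most with the exponential rate given by the largest input
entropy of the reduced channel. -/
theorem AchievableSize.eventually_lt (hz : C.IsRepresentative φ z) {A h R : ℝ} {size : ℕ → ℕ}
    (hsize : C.AchievableSize φ A size)
    (hh : h ∈ upperBounds ((C.reduced z).inputEntropies (fun x => φ x) A)) (hR : h < R) :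
    ∀ᶠ n : ℕ in atTop, (size n : ℝ) < (2 : ℝ) ^ ((n : ℝ) * R) := by
  have hlog : 0 < Real.log 2 := Real.log_pos one_lt_two
  set b : ℝ := (R - h) * Real.log 2 with hb
  have hb0 : 0 < b := mul_pos (sub_pos.mpr hR) hlog
  -- The bound is used at `n + 1`: `exp (-b)` undoes this shift, and the factor `1 / 2` yields
  -- strict inequality.
  have hpoly := (isLittleO_pow_exp_pos_mul_atTop (Fintype.card (C.reducedAlphabet z)) hb0).def
    (c := Real.exp (-b) / 2) (by positivity)
  have hpoly' := (tendsto_natCast_atTop_atTop.comp (tendsto_add_atTop_nat 1)).eventually hpoly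
  filter_upwards [hsize (1 / 4) (1 / 4) (by norm_num) (by norm_num), eventually_gt_atTop 0, hpoly']
    with n ⟨c⟩ hn hp
  have h1 : (size n : ℝ) ≤ _ := (Nat.cast_le.mpr (C.card_le_of_diCode hz (by norm_num) c)).trans
    (card_seqCost_le (fun a : C.reducedAlphabet z => φ a) A (H := h * Real.log 2)
      (fun p hp hpA => by
        have := hh ⟨p, hp, hpA, rfl⟩
        rwa [entropyBits_eq, div_le_iff₀ hlog] at this) hn)
  simp only [Function.comp_apply, Nat.cast_add, Nat.cast_one, Real.norm_eq_abs, Real.abs_exp,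
    abs_of_nonneg (by positivity : (0 : ℝ) ≤ ((n : ℝ) + 1) ^ _)] at hp
  refine h1.trans_lt ?_
  calc ((n : ℝ) + 1) ^ Fintype.card (C.reducedAlphabet z) * Real.exp (n * (h * Real.log 2))
      ≤ Real.exp (-b) / 2 * Real.exp (b * (n + 1)) * Real.exp (n * (h * Real.log 2)) :=
        mul_le_mul_of_nonneg_right hp (Real.exp_pos _).le
    _ = Real.exp (Real.log 2 * (n * R)) / 2 := by
        rw [div_mul_eq_mul_div, div_mul_eq_mul_div, ← Real.exp_add, ← Real.exp_add]
        congr 2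
        rw [hb]
        ring
    _ < _ := by
        rw [Real.rpow_def_of_pos two_pos]
        exact half_lt_self (Real.exp_pos _)

end Converse

/-! ### The entropy maximum and slack in the cost constraint. -/

section Capacity

theorem continuous_entropyBits : Continuous (entropyBits : (X → ℝ) → ℝ) := by
  rw [funext entropyBits_eq]
  exact (continuous_finsetSum _ fun a _ =>
    Real.continuous_negMulLog.comp (continuous_apply a)).div_const _

/-- Entropy is continuous on the compact set of admissible laws, which contains a point mass at an
admissible letter. -/
theorem exists_isGreatest_inputEntropies {φ : X → ℝ} {A : ℝ} (h₀ : ∃ x, φ x ≤ A) :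
    ∃ h, IsGreatest (C.inputEntropies φ A) h := by
  classical
  obtain ⟨x, hx⟩ := h₀
  have hcomp : IsCompact (stdSimplex ℝ X ∩ {p | ∑ a, p a * φ a ≤ A}) :=
    (isCompact_stdSimplex ℝ X).inter_right (isClosed_le (by fun_prop) continuous_const)
  have hne : (stdSimplex ℝ X ∩ {p | ∑ a, p a * φ a ≤ A}).Nonempty :=
    ⟨Pi.single x 1, single_mem_stdSimplex ℝ x, by simpa [Pi.single_apply] using hx⟩
  obtain ⟨p, hp, hmax⟩ := hcomp.exists_isMaxOn hne continuous_entropyBits.continuousOn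
  refine ⟨entropyBits p, ⟨p, hp.1, hp.2, rfl⟩, ?_⟩
  rintro _ ⟨q, hq, hqA, rfl⟩
  exact hmax ⟨hq, hqA⟩

/-- An admissible input law can be replaced by one that has a strictly smaller cost, or only uses
letters of admissible cost, at an arbitrarily small loss of entropy. -/
theorem exists_slack {φ : X → ℝ} (hφ : ∀ x, 0 ≤ φ x) {x₀ : X} (hx₀ : φ x₀ = 0) {A R : ℝ}
    (hA : 0 ≤ A) {p : X → ℝ} (hp : p ∈ stdSimplex ℝ X) (hpA : ∑ a, p a * φ a ≤ A)
    (hR : R < entropyBits p) :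
    ∃ q ∈ stdSimplex ℝ X, (∑ a, q a * φ a < A ∨ ∀ a, q a ≠ 0 → φ a ≤ A) ∧
      R < entropyBits q := by
  classical
  -- For `A = 0` no slack can be gained, but `p` then charges only letters of zero cost. For `A >
  -- 0`, mixing in a little of the free letter `x₀` scales the cost by `1 - s`, and entropy is
  -- continuous.
  rcases hA.eq_or_lt with rfl | hA
  · refine ⟨p, hp, Or.inr fun a ha => ?_, hR⟩
    have h0 : ∑ a, p a * φ a = 0 :=
      le_antisymm hpA (Finset.sum_nonneg fun a _ => mul_nonneg (hp.1 a) (hφ a))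
    have := (Finset.sum_eq_zero_iff_of_nonneg fun a _ => mul_nonneg (hp.1 a) (hφ a)).mp h0 a
      (Finset.mem_univ a)
    exact ((mul_eq_zero.mp this).resolve_left ha).le
  · set q : ℝ → X → ℝ := fun s a => (1 - s) * p a + s * (Pi.single x₀ 1 : X → ℝ) a with hq
    have hcont : Continuous fun s => entropyBits (q s) :=
      continuous_entropyBits.comp (by fun_prop)
    have hq0 : q 0 = p := by funext a; simp [hq]
    have hnear : ∀ᶠ s in nhds (0 : ℝ), R < entropyBits (q s) :=
      hcont.continuousAt.eventually_const_lt (by simpa only [hq0] using hR)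
    have hright : ∀ᶠ s in nhdsWithin (0 : ℝ) (Set.Ioi 0), R < entropyBits (q s) ∧ s ∈ Set.Ioo 0 1 :=
      (hnear.filter_mono nhdsWithin_le_nhds).and (Ioo_mem_nhdsGT one_pos)
    obtain ⟨s, hs, hs0, hs1⟩ := hright.exists
    refine ⟨q s, convex_stdSimplex ℝ X hp (single_mem_stdSimplex ℝ x₀) (sub_nonneg.mpr hs1.le)
      hs0.le (sub_add_cancel _ _), Or.inl ?_, hs⟩
    have hcost : ∑ a, q s a * φ a = (1 - s) * ∑ a, p a * φ a := by
      simp only [hq, add_mul, Finset.sum_add_distrib, Finset.mul_sum, mul_assoc]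
      simp [Pi.single_apply, hx₀]
    rw [hcost]
    nlinarith

end Capacity

end DMC

/-! ### The capacity formula. -/

theorem mainTheorem1 {X Y : Type*} [Fintype X] [Fintype Y] (C : DMC X Y)
    (φ : X → ℝ) (hφ : ∀ x, 0 ≤ φ x) (hφ₀ : ∃ x₀, φ x₀ = 0)
    (A : ℝ) (hA : 0 ≤ A)
    (z : Quotient C.rowSetoid → X) (hz : C.IsRepresentative φ z) :
    (∃ h : ℝ,
      IsGreatest ((C.reduced z).inputEntropies (fun x => φ x) A) h ∧
        C.diCapacity φ A = ENNReal.ofReal h) ∧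
      C.diCapacityDoubleExp φ A = 0 := by
  obtain ⟨x₀, hx₀⟩ := hφ₀
  have hr₀ : φ (C.representative z x₀) = 0 :=
    le_antisymm (hx₀ ▸ C.cost_representative_le hz x₀) (hφ _)
  obtain ⟨h, hgreatest⟩ := (C.reduced z).exists_isGreatest_inputEntropies
    (φ := fun x => φ x) (A := A) ⟨C.representative z x₀, hr₀.trans_le hA⟩
  refine ⟨⟨h, hgreatest, le_antisymm ?_ ?_⟩, ?_⟩
  · refine sSup_le ?_
    rintro _ ⟨R, ⟨-, hR⟩, rfl⟩
    refine ENNReal.ofReal_le_ofReal (le_of_not_gt fun hlt => ?_)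
    -- The converse is applied with exponent `R` itself, and rounding up only enlarges the code.
    obtain ⟨n, hn⟩ := (DMC.AchievableSize.eventually_lt C hz hR hgreatest.2 hlt).exists
    exact absurd hn (not_lt.mpr (Nat.le_ceil _))
  -- Testing below `ENNReal.ofReal h` makes the rate `R > c.toReal` automatically positive, and the
  -- case `h = 0` vacuous.
  · refine le_of_forall_lt fun c hc => ?_
    obtain ⟨p, hp, hpA, hpH⟩ := hgreatest.1
    have hctop : c ≠ ⊤ := hc.ne_top
    have hch : c.toReal < h := (ENNReal.lt_ofReal_iff_toReal_lt hctop).mp hc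
    obtain ⟨R, hcR, hRh⟩ := exists_between hch
    obtain ⟨q, hq, hqA, hqR⟩ := DMC.exists_slack (φ := fun x : C.reducedAlphabet z => φ x)
      (fun x => hφ x) hr₀ hA hp hpA (hpH ▸ hRh)
    have hach : C.AchievableRate φ A R := DMC.AchievableSize.of_reduced C
      ((C.reduced z).achievableRate_of_lt_entropyBits (C.reduced_W_injective hz) hq hqA hqR)
    refine lt_of_lt_of_le ?_ (le_sSup ⟨R, ⟨ENNReal.toReal_nonneg.trans_lt hcR, hach⟩, rfl⟩)
    exact (ENNReal.lt_ofReal_iff_toReal_lt hctop).mpr hcR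
  · refine le_antisymm (sSup_le ?_) bot_le
    rintro _ ⟨R, ⟨hR0, hR⟩, rfl⟩
    exfalso
    have hb : 0 < Real.log 2 * R := mul_pos (Real.log_pos one_lt_two) hR0
    -- This constant gives `n * (|h| + 1) ≤ 2 ^ (n * R)` for large `n`, so a double-exponential code
    -- would exceed the converse bound at rate `|h| + 1 > h`.
    have hlin := ((isLittleO_pow_exp_pos_mul_atTop 1 hb).def
      (c := 1 / (|h| + 1)) (by positivity))
    obtain ⟨n, hn, hlt⟩ := ((tendsto_natCast_atTop_atTop.eventually hlin).and
      (DMC.AchievableSize.eventually_lt C hz hR hgreatest.2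
        ((le_abs_self h).trans_lt (lt_add_one _)))).exists
    refine absurd hlt (not_lt.mpr (le_trans ?_ (Nat.le_ceil _)))
    refine Real.rpow_le_rpow_of_exponent_le one_le_two ?_
    rw [Real.rpow_def_of_pos two_pos]
    simp only [pow_one, Real.norm_eq_abs, Nat.abs_cast, Real.abs_exp] at hn
    rw [one_div, ← div_eq_inv_mul, le_div_iff₀ (by positivity)] at hn
    refine hn.trans_eq ?_
    congr 1
    ring
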